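/- Let $q$ be a power of a prime, let $n$ be a positive integer coprime to $q$, let $m=\operatorname{ord}_n(q)$ be the multiplicative order of $q$ modulo $n$, and assume $m\ge 2$. Let $\delta_1,\delta_2$ be integers with $2\le \delta_1<\delta_2\le\delta_{\max}$, where $$\delta_{\max}=\frac{n}{q^m-1}\Bigl(q^{\lceil m/2\rceil}-1-(q-2)\,[m\text{ odd}]\Bigr),$$ and $[m\text{ odd}]$ is $1$ if $m$ is odd and $0$ otherwise. Then there exists a quantum stabilizer code with parameters $$\Bigl[\Bigl[\,n,\; m\bigl(\delta_2-\delta_1-\lfloor(\delta_2-1)/q\rfloor+\lfloor(\delta_1-1)/q\rfloor\bigr),\; \ge\delta_1\Bigr]\Bigr]_q$$ that is pure to $\delta_2$. More precisely, let $\alpha$ be any primitive $n$-th root of unity in an algebraic closure of $\mathbf F_q$, and let $B_i\subseteq\mathbf F_q^n$ $(i=1,2)$ be the narrow-sense BCH code of length $n$ and designed distance $\delta_i$, that is, the cyclic code with generator polynomial $\prod_{z\in Z_i}(x-\alpha^z)$, where $Z_i=C_1\cup\dots\cup C_{\delta_i-1}$ and $C_x=\{xq^k \bmod n : k\ge 0\}$.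 Then $B_2\subseteq B_1$, and the CSS code of this pair has the stated parameters and is pure to $\delta_2$. Here the state space is $\mathbf C^{q^n}$ with orthonormal basis $|x\rangle$, $x\in\mathbf F_q^n$; the error operators are the unit complex multiples of the $X(a)Z(b)$ with $a,b\in\mathbf F_q^n$, where $X(a)|x\rangle=|x+a\rangle$ and $Z(b)|x\rangle=e^{2\pi i\operatorname{tr}(b\cdot x)/p}|x\rangle$, with $p$ the characteristic of $\mathbf F_q$ and $\operatorname{tr}$ the trace to $\mathbf F_p$; the weight of such an operator is the number of positions $i$ with $(a_i,b_i)\ne(0,0)$. The stabilizer of a subspace is the set of error operators that fix each of its vectors. A stabilizer code is a non-zero subspace $Q$ that is the joint fixed space of its stabilizer; it is pure to $t$ if its stabilizer contains no non-scalar operator of weight less than $t$. It has parameters $[[n,k,\ge d]]_q$ if $\dim Q=q^k$ and $Q$ detects every error operator $E$ of weight less than $d$ (that is, $PEP$ is a scalar multiple of the orthogonal projection $P$ onto $Q$) and, in case $\dim Q=1$, $Q$ is also pure to $d$. The CSS code of $B_2\subseteq B_1$ is the joint fixed space of all $X(a)$ with $a\in B_2$ and all $Z(b)$ with $b$ in the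 Euclidean dual $B_1^\perp$. -/

import Mathlib

/-- The `q`-ary cyclotomic coset `{x q ^ k mod n | k ≥ 0}` of `x` modulo `n`. -/
noncomputable def cyclotomicCoset (q n x : ℕ) : Finset ℕ :=
  open Classical in (Finset.range n).filter fun z => ∃ k : ℕ, z = x * q ^ k % n

/-- The defining set `C_b ∪ ⋯ ∪ C_{b + δ - 2}` of a BCH code. -/
noncomputable def bchDefiningSet (q n b δ : ℕ) : Finset ℕ :=
  (Finset.Ico b (b + δ - 1)).biUnion (cyclotomicCoset q n)

/-- The polynomial `c₀ + c₁ X + ⋯ + c_{n-1} X ^ (n-1)` attached to a word `c` of length `n`. -/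
noncomputable def wordPoly {F : Type*} [Field F] {n : ℕ} (c : Fin n → F) : Polynomial F :=
  ∑ i : Fin n, Polynomial.monomial (i : ℕ) (c i)

/-- The product of `X - α ^ z` over `z ∈ Z`. -/
noncomputable def generatorPoly {K : Type*} [Field K] (α : K) (Z : Finset ℕ) : Polynomial K :=
  ∏ z ∈ Z, (Polynomial.X - Polynomial.C (α ^ z))

/-- The BCH code of length `n` over the finite field `F` with `q` elements, with designed
distance `δ` and offset `b`: all words whose polynomial is a multiple of the generator polynomial
`∏ (X - α ^ z)`, where `z` runs through `C_b ∪ ⋯ ∪ C_{b + δ - 2}`. Here `α`, in an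
extension field of `F`, is meant to be a primitive `n`-th root of unity. -/
noncomputable def bchCode {F K : Type*} [Field F] [Fintype F] [Field K] [Algebra F K]
    (n b δ : ℕ) (α : K) : Submodule F (Fin n → F) where
  carrier := {c | generatorPoly α (bchDefiningSet (Fintype.card F) n b δ) ∣
    (wordPoly c).map (algebraMap F K)}
  zero_mem' := by simp [wordPoly]
  add_mem' := by
    intro c d hc hd
    have h : wordPoly (c + d) = wordPoly c + wordPoly d := by
      simp [wordPoly, Finset.sum_add_distrib]
    simp only [Set.mem_ofPred_eq, h, Polynomial.map_add] at *
    exact dvd_add hc hd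
  smul_mem' := by
    intro r c hc
    have h : wordPoly (r • c) = Polynomial.C r * wordPoly c := by
      simp [wordPoly, Finset.mul_sum, Polynomial.C_mul_monomial]
    simp only [Set.mem_ofPred_eq, h, Polynomial.map_mul] at *
    exact Dvd.dvd.mul_left hc _

/-- The narrow-sense BCH code of length `n` and designed distance `δ`. -/
noncomputable def narrowSenseBCH {F K : Type*} [Field F] [Fintype F] [Field K] [Algebra F K]
    (n δ : ℕ) (α : K) : Submodule F (Fin n → F) :=
  bchCode n 1 δ α

/-- The Euclidean dual code. -/
def euclideanDual {F : Type*} [Field F] {n : ℕ} (C : Submodule F (Fin n → F)) :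
    Submodule F (Fin n → F) where
  carrier := {y | ∀ x ∈ C, x ⬝ᵥ y = 0}
  zero_mem' := by simp
  add_mem' := by
    intro y z hy hz x hx
    rw [dotProduct_add, hy x hx, hz x hx, add_zero]
  smul_mem' := by
    intro r y hy x hx
    rw [dotProduct_smul, hy x hx, smul_zero]

/-- The state space of `n` quantum systems of `q` levels each, `q` being the size of `F`: the
Hilbert space `(ℂ^q)^{⊗ n} = ℂ^(q^n)`, with orthonormal basis indexed by `Fⁿ`. -/
abbrev QState (F : Type*) [Fintype F] (n : ℕ) : Type _ := EuclideanSpace ℂ (Fin n → F)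

/-- The additive character `x ↦ exp (2 π i tr x / p)` of a finite field of characteristic `p`,
`tr` being the trace to the prime field. -/
noncomputable def traceChar (F : Type*) [Field F] [Fintype F] : AddChar F ℂ :=
  haveI : Fact (ringChar F).Prime := ⟨CharP.char_is_prime F (ringChar F)⟩
  letI : Algebra (ZMod (ringChar F)) F := ZMod.algebra F (ringChar F)
  (ZMod.stdAddChar (N := ringChar F)).compAddMonoidHom
    (Algebra.trace (ZMod (ringChar F)) F).toAddMonoidHom

/-- The shift operator `X(a)`, `|x⟩ ↦ |x + a⟩`. -/
noncomputable def shiftOp {F : Type*} [Field F] [Fintype F] {n : ℕ} (a : Fin n → F) :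
    QState F n →ₗ[ℂ] QState F n where
  toFun v := WithLp.toLp 2 fun x => v (x - a)
  map_add' _ _ := rfl
  map_smul' _ _ := rfl

/-- The phase operator `Z(b)`, `|x⟩ ↦ ω ^ tr (b ⬝ x) |x⟩`, where `ω = exp (2 π i / p)`. -/
noncomputable def phaseOp {F : Type*} [Field F] [Fintype F] {n : ℕ} (b : Fin n → F) :
    QState F n →ₗ[ℂ] QState F n where
  toFun v := WithLp.toLp 2 fun x => traceChar F (b ⬝ᵥ x) * v x
  map_add' v w := by ext x; simp [mul_add]
  map_smul' r v := by ext x; simp [mul_left_comm]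

/-- The error operator `z X(a) Z(b)`; `z` is a phase. -/
noncomputable def errorOp {F : Type*} [Field F] [Fintype F] {n : ℕ} (z : Circle)
    (a b : Fin n → F) : QState F n →ₗ[ℂ] QState F n :=
  (z : ℂ) • (shiftOp a ∘ₗ phaseOp b)

/-- The weight of `z X(a) Z(b)`: the number of positions at which it is not a scalar. -/
noncomputable def errorWeight {F : Type*} [Field F] {n : ℕ} (a b : Fin n → F) : ℕ :=
  open Classical in (Finset.univ.filter fun i => a i ≠ 0 ∨ b i ≠ 0).card

/-- `Q` is a stabilizer code: it is non-zero and is the joint fixed space of the error operators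
that fix every vector of `Q`. -/
def IsStabilizerCode {F : Type*} [Field F] [Fintype F] {n : ℕ}
    (Q : Submodule ℂ (QState F n)) : Prop :=
  Q ≠ ⊥ ∧ ∀ v : QState F n,
    (∀ (z : Circle) (a b : Fin n → F), (∀ w ∈ Q, errorOp z a b w = w) → errorOp z a b v = v) →
      v ∈ Q

/-- `Q` detects the error `E`: `P E P` is a multiple of `P`, the orthogonal projection on `Q`. -/
def Detects {F : Type*} [Field F] [Fintype F] {n : ℕ}
    (Q : Submodule ℂ (QState F n)) (E : QState F n →ₗ[ℂ] QState F n) : Prop :=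
  ∃ l : ℂ, ∀ v ∈ Q, ∀ w ∈ Q, inner ℂ v (E w) = l * inner ℂ v w

/-- `Q` is pure to `t`: its stabilizer has no non-scalar error operator of weight below `t`. -/
def IsPureTo {F : Type*} [Field F] [Fintype F] {n : ℕ}
    (Q : Submodule ℂ (QState F n)) (t : ℕ) : Prop :=
  ∀ (z : Circle) (a b : Fin n → F), (∀ w ∈ Q, errorOp z a b w = w) →
    0 < errorWeight a b → t ≤ errorWeight a b

/-- `Q` has minimum distance at least `d`: it detects all errors of weight below `d`. By the usual
convention a one-dimensional code (for which every error is detectable) must moreover be pure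
to `d`. -/
def HasMinDistGE {F : Type*} [Field F] [Fintype F] {n : ℕ}
    (Q : Submodule ℂ (QState F n)) (d : ℕ) : Prop :=
  (∀ (z : Circle) (a b : Fin n → F), errorWeight a b < d → Detects Q (errorOp z a b)) ∧
    (Module.finrank ℂ Q = 1 → IsPureTo Q d)

/-- `Q` is an `[[n, k, ≥ d]]_q` stabilizer code, `q` being the size of `F`. -/
def IsQuantumCode {F : Type*} [Field F] [Fintype F] {n : ℕ}
    (Q : Submodule ℂ (QState F n)) (k : ℤ) (d : ℕ) : Prop :=
  IsStabilizerCode Q ∧ (Module.finrank ℂ Q : ℝ) = (Fintype.card F : ℝ) ^ k ∧ HasMinDistGE Q d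

/-- The CSS code of a pair `C₁ ⊆ C₂`: the joint fixed space of all `X(a)` with `a ∈ C₁` and all
`Z(b)` with `b` in the dual of `C₂`. -/
noncomputable def cssCode {F : Type*} [Field F] [Fintype F] {n : ℕ}
    (C₁ C₂ : Submodule F (Fin n → F)) : Submodule ℂ (QState F n) :=
  (⨅ a ∈ C₁, LinearMap.eqLocus (shiftOp a) LinearMap.id) ⊓
    (⨅ b ∈ euclideanDual C₂, LinearMap.eqLocus (phaseOp b) LinearMap.id)

/-! ### CSS codes: dimension, detectable errors and purity. -/

section QuantumCode

variable {F : Type*} [Field F] {n : ℕ}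

/-! The CSS code of `B₂ ≤ B₁` is the space of `B₂`-periodic functions supported on `B₁`, of
dimension `q ^ (dim B₁ - dim B₂)`. An error `X(a)Z(b)` compresses to zero on it unless `a ∈ B₁` and
`b ∈ B₂^⊥`, and an error fixing it has `a ∈ B₂` and `b ∈ B₁^⊥ ≤ B₂^⊥`. Distance and purity thus
follow from lower bounds on the weights in `B₁`, `B₂` and `B₂^⊥` (`isQuantumCode_cssCode`). The BCH
bound serves the first two; for the third it suffices that `B₂^⊥ ≤ B₂`.

The hypothesis on `δ₂` enters through one inequality (`mul_pow_add_lt_of_le`): `x q^k + y < n` for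
`x, y < δ₂` and `k ≤ m / 2`. Congruences modulo `n` between such numbers are then equalities of
integers. As `q^m = 1` modulo `n`, an exponent above `m / 2` can be moved to the other side, where
it becomes at most `m / 2`. Hence no two elements of the defining set sum to zero modulo `n`, which
gives `B₂^⊥ ≤ B₂`; and the cosets of the `x < δ` prime to the divisor `q` (that is, `q ∤ x`) are
disjoint of full size `m`, which gives the dimensions. -/

lemma euclideanDual_anti {C D : Submodule F (Fin n → F)} (h : C ≤ D) :
    euclideanDual D ≤ euclideanDual C := fun _ hy x hx => hy x (h hx)

/-- Some linear functional vanishes on `C` but not at `x`, and every functional is the dot product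
with the vector of its values on the standard basis. -/
lemma exists_mem_euclideanDual_dotProduct_ne_zero {C : Submodule F (Fin n → F)} {x : Fin n → F}
    (hx : x ∉ C) : ∃ b ∈ euclideanDual C, b ⬝ᵥ x ≠ 0 := by
  classical
  obtain ⟨f, hfx, hf⟩ := Submodule.exists_le_ker_of_notMem hx
  have hdot : ∀ y, f y = (fun i => f (Pi.single i 1)) ⬝ᵥ y := by
    intro y
    rw [LinearMap.pi_apply_eq_sum_univ f y]
    refine Finset.sum_congr rfl fun i _ => ?_
    rw [smul_eq_mul, mul_comm]
    congr 2
    ext j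
    simp [Pi.single_apply, eq_comm]
  refine ⟨fun i => f (Pi.single i 1), fun y hy => ?_, by rwa [← hdot]⟩
  rw [dotProduct_comm, ← hdot]
  exact hf hy

lemma hammingNorm_le_errorWeight_left [DecidableEq F] (a b : Fin n → F) :
    hammingNorm a ≤ errorWeight a b := by
  classical
  exact Finset.card_le_card fun i hi => by
    simp only [Finset.mem_filter, Finset.mem_univ, true_and] at hi ⊢
    exact Or.inl hi

lemma hammingNorm_le_errorWeight_right [DecidableEq F] (a b : Fin n → F) :
    hammingNorm b ≤ errorWeight a b := by
  classical
  exact Finset.card_le_card fun i hi => by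
    simp only [Finset.mem_filter, Finset.mem_univ, true_and] at hi ⊢
    exact Or.inr hi

variable [Fintype F]

/-- The trace form is nondegenerate and the standard character of `ZMod p` is injective. Scaling by
`r` thereby turns trivial character values into `F`-linear orthogonality. -/
lemma traceChar_apply_eq_one_iff {s : F} : (∀ r : F, traceChar F (s * r) = 1) ↔ s = 0 := by
  refine ⟨fun h => ?_, fun h r => by simp [h]⟩
  have : Fact (ringChar F).Prime := ⟨CharP.char_is_prime F (ringChar F)⟩
  let _ : Algebra (ZMod (ringChar F)) F := ZMod.algebra F (ringChar F)
  by_contra hs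
  obtain ⟨b, hb⟩ := FiniteField.trace_to_zmod_nondegenerate F hs
  refine hb (ZMod.injective_stdAddChar ?_)
  rw [AddChar.map_zero_eq_one]
  exact h b

/-- A submodule on which the trace character of `b ⬝ᵥ x` is trivial is orthogonal to `b`. -/
lemma dotProduct_eq_zero_of_traceChar_eq_one {C : Submodule F (Fin n → F)} {b : Fin n → F}
    (h : ∀ y ∈ C, traceChar F (b ⬝ᵥ y) = 1) {y : Fin n → F} (hy : y ∈ C) : b ⬝ᵥ y = 0 := by
  refine traceChar_apply_eq_one_iff.1 fun r => ?_
  have := h (r • y) (C.smul_mem r hy)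
  rwa [dotProduct_smul, smul_eq_mul, mul_comm] at this

lemma errorOp_apply (z : Circle) (a b x : Fin n → F) (v : QState F n) :
    errorOp z a b v x = z * (traceChar F (b ⬝ᵥ (x - a)) * v (x - a)) := rfl

lemma errorOp_one_shift (a : Fin n → F) : errorOp 1 a 0 = shiftOp a := by
  ext v x
  rw [errorOp_apply, zero_dotProduct, AddChar.map_zero_eq_one, one_mul, Circle.coe_one, one_mul]
  rfl

lemma errorOp_one_phase (b : Fin n → F) : errorOp 1 0 b = phaseOp b := by
  ext v x
  simp [errorOp_apply, phaseOp]

lemma mem_cssCode {C₁ C₂ : Submodule F (Fin n → F)} {v : QState F n} :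
    v ∈ cssCode C₁ C₂ ↔
      (∀ a ∈ C₁, shiftOp a v = v) ∧ ∀ b ∈ euclideanDual C₂, phaseOp b v = v := by
  simp [cssCode, LinearMap.mem_eqLocus]

/-- The CSS code consists of the `C₁`-periodic functions supported on `C₂`. -/
lemma mem_cssCode_iff_periodic {C₁ C₂ : Submodule F (Fin n → F)} {v : QState F n} :
    v ∈ cssCode C₁ C₂ ↔ (∀ a ∈ C₁, ∀ x, v (x - a) = v x) ∧ ∀ x ∉ C₂, v x = 0 := by
  rw [mem_cssCode]
  refine and_congr ?_ ⟨fun h x hx => ?_, fun h b hb => ?_⟩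
  · refine forall₂_congr fun a _ => ?_
    rw [WithLp.ext_iff, funext_iff]
    rfl
  · obtain ⟨b, hb, hbx⟩ := exists_mem_euclideanDual_dotProduct_ne_zero hx
    by_contra hv
    refine hbx (traceChar_apply_eq_one_iff.1 fun r => ?_)
    have h1 := congrArg (fun w : QState F n => w x) (h _ ((euclideanDual C₂).smul_mem r hb))
    have h2 : traceChar F ((r • b) ⬝ᵥ x) * v x = v x := h1
    rw [smul_dotProduct, smul_eq_mul, mul_comm r] at h2
    exact mul_right_cancel₀ hv (h2.trans (one_mul _).symm)
  · ext x
    change traceChar F (b ⬝ᵥ x) * v x = v x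
    by_cases hx : x ∈ C₂
    · rw [dotProduct_comm, hb x hx, AddChar.map_zero_eq_one, one_mul]
    · rw [h x hx, mul_zero]

/-- The unnormalised uniform superposition of the coset `y + C`. -/
noncomputable def cosetState (C : Submodule F (Fin n → F)) (y : Fin n → F) : QState F n :=
  open Classical in WithLp.toLp 2 fun x => if x - y ∈ C then 1 else 0

lemma cosetState_apply_of_mem {C : Submodule F (Fin n → F)} {x y : Fin n → F} (h : x - y ∈ C) :
    cosetState C y x = 1 := by
  simp [cosetState, h]

lemma cosetState_apply_of_notMem {C : Submodule F (Fin n → F)} {x y : Fin n → F}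
    (h : x - y ∉ C) : cosetState C y x = 0 := by
  simp [cosetState, h]

lemma cosetState_mem_cssCode {C₁ C₂ : Submodule F (Fin n → F)} (h : C₁ ≤ C₂) {y : Fin n → F}
    (hy : y ∈ C₂) : cosetState C₁ y ∈ cssCode C₁ C₂ := by
  rw [mem_cssCode_iff_periodic]
  refine ⟨fun a ha x => ?_, fun x hx => cosetState_apply_of_notMem fun hxy => hx ?_⟩
  · by_cases hxy : x - y ∈ C₁
    · rw [cosetState_apply_of_mem hxy, cosetState_apply_of_mem]
      rw [sub_right_comm]
      exact C₁.sub_mem hxy ha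
    · rw [cosetState_apply_of_notMem hxy, cosetState_apply_of_notMem]
      rw [sub_right_comm]
      exact fun h' => hxy (by simpa using C₁.add_mem h' ha)
  · simpa using C₂.add_mem (h hxy) hy

/-- An error operator fixing the CSS code of `C₁ ≤ C₂` has its shift part in `C₁` and its phase
part in the dual of `C₂`. -/
lemma mem_of_errorOp_fixes_cssCode {C₁ C₂ : Submodule F (Fin n → F)} (h : C₁ ≤ C₂) {z : Circle}
    {a b : Fin n → F} (hfix : ∀ w ∈ cssCode C₁ C₂, errorOp z a b w = w) :
    a ∈ C₁ ∧ b ∈ euclideanDual C₂ := by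
  -- Compare the coset state of `y` with its image under the error at the point `y + a`. The left
  -- side is never zero, which forces `a ∈ C₁`.
  have key : ∀ y ∈ C₂,
      (z : ℂ) * traceChar F (b ⬝ᵥ y) = cosetState C₁ y (y + a) := by
    intro y hy
    have h1 := congrArg (fun w : QState F n => w (y + a))
      (hfix _ (cosetState_mem_cssCode h hy))
    simp only [errorOp_apply, add_sub_cancel_right] at h1
    rwa [cosetState_apply_of_mem (x := y) (by simp), mul_one] at h1
  have ha : a ∈ C₁ := by
    by_contra ha
    have h0 := key 0 C₂.zero_mem
    rw [cosetState_apply_of_notMem (by simpa using ha), dotProduct_zero,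
      AddChar.map_zero_eq_one, mul_one] at h0
    exact z.coe_ne_zero h0
  have key' : ∀ y ∈ C₂, (z : ℂ) * traceChar F (b ⬝ᵥ y) = 1 := by
    intro y hy
    rw [key y hy, cosetState_apply_of_mem (by simpa using ha)]
  have hz : (z : ℂ) = 1 := by simpa using key' 0 C₂.zero_mem
  refine ⟨ha, fun y hy => ?_⟩
  rw [dotProduct_comm]
  refine dotProduct_eq_zero_of_traceChar_eq_one (C := C₂) (fun y hy => ?_) hy
  simpa [hz] using key' y hy

lemma isStabilizerCode_cssCode {C₁ C₂ : Submodule F (Fin n → F)} (h : C₁ ≤ C₂) :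
    IsStabilizerCode (cssCode C₁ C₂) := by
  refine ⟨fun hbot => ?_, fun v hv => mem_cssCode.2 ⟨fun a ha => ?_, fun b hb => ?_⟩⟩
  · have h0 := cosetState_mem_cssCode h C₂.zero_mem
    rw [hbot, Submodule.mem_bot] at h0
    have h1 := cosetState_apply_of_mem (C := C₁) (x := 0) (y := 0) (by simp)
    rw [h0] at h1
    exact zero_ne_one h1
  · rw [← errorOp_one_shift]
    refine hv 1 a 0 fun w hw => ?_
    rw [errorOp_one_shift]
    exact (mem_cssCode.1 hw).1 a ha
  · rw [← errorOp_one_phase]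
    refine hv 1 0 b fun w hw => ?_
    rw [errorOp_one_phase]
    exact (mem_cssCode.1 hw).2 b hb

/-- The CSS code of `C₁ ≤ C₂` is the space of functions on `C₂ ⧸ C₁`. -/
noncomputable def cssCodeEquiv {C₁ C₂ : Submodule F (Fin n → F)} (h : C₁ ≤ C₂) :
    cssCode C₁ C₂ ≃ₗ[ℂ] ((C₂ ⧸ C₁.submoduleOf C₂) → ℂ) where
  toFun v := fun c => Quotient.liftOn' c (fun x : C₂ => (v : QState F n) (x : Fin n → F)) <| by
    intro x y hxy
    have h1 : (x : Fin n → F) - y ∈ C₁ :=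
      (Submodule.quotientRel_def (C₁.submoduleOf C₂)).1 hxy
    have h2 := (mem_cssCode_iff_periodic.1 v.2).1 _ h1 x
    rw [sub_sub_cancel] at h2
    exact h2.symm
  map_add' v w := by
    ext c
    induction c using Quotient.inductionOn'
    rfl
  map_smul' r v := by
    ext c
    induction c using Quotient.inductionOn'
    rfl
  invFun f := ⟨open Classical in WithLp.toLp 2 fun x =>
      if hx : x ∈ C₂ then f (Submodule.Quotient.mk ⟨x, hx⟩) else 0, by
    rw [mem_cssCode_iff_periodic]
    refine ⟨fun a ha x => ?_, fun x hx => by simp [hx]⟩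
    by_cases hx : x ∈ C₂
    · have hxa : x - a ∈ C₂ := C₂.sub_mem hx (h ha)
      simp only [hx, hxa, dif_pos]
      congr 1
      rw [Submodule.Quotient.eq]
      simpa [Submodule.submoduleOf] using ha
    · have hxa : x - a ∉ C₂ := fun h' => hx (by simpa using C₂.add_mem h' (h ha))
      simp [hx, hxa]⟩
  left_inv v := by
    ext x
    by_cases hx : x ∈ C₂
    · simp only [hx, dif_pos]
      rfl
    · simp only [hx, dif_neg, not_false_eq_true]
      exact ((mem_cssCode_iff_periodic.1 v.2).2 x hx).symm
  right_inv f := by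
    ext c
    induction c using Quotient.inductionOn' with
    | h x =>
      exact dif_pos x.2

lemma finrank_cssCode {C₁ C₂ : Submodule F (Fin n → F)} (h : C₁ ≤ C₂) :
    Module.finrank ℂ (cssCode C₁ C₂) =
      Fintype.card F ^ (Module.finrank F C₂ - Module.finrank F C₁) := by
  classical
  have : Fintype (C₂ ⧸ C₁.submoduleOf C₂) := Fintype.ofFinite _
  rw [(cssCodeEquiv h).finrank_eq, Module.finrank_fintype_fun_eq_card,
    Module.card_eq_pow_finrank (K := F)]
  congr 1
  have h1 := Submodule.finrank_quotient_add_finrank (C₁.submoduleOf C₂)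
  rw [(Submodule.submoduleOfEquivOfLe h).finrank_eq] at h1
  omega

/-- The error moves the support from `C₂` into the disjoint coset `a + C₂`, so all inner products
vanish. -/
lemma detects_cssCode_of_shift_notMem {C₁ C₂ : Submodule F (Fin n → F)} {a : Fin n → F}
    (ha : a ∉ C₂) (z : Circle) (b : Fin n → F) :
    Detects (cssCode C₁ C₂) (errorOp z a b) := by
  refine ⟨0, fun v hv w hw => ?_⟩
  rw [zero_mul, PiLp.inner_apply]
  refine Finset.sum_eq_zero fun x _ => ?_
  by_cases hx : x ∈ C₂
  · have hxa : x - a ∉ C₂ := fun h' => ha (by simpa using C₂.sub_mem hx h')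
    simp [errorOp_apply, (mem_cssCode_iff_periodic.1 hw).2 _ hxa]
  · simp [(mem_cssCode_iff_periodic.1 hv).2 _ hx]

/-- Translating the summation variable by a suitable `c ∈ C₁` preserves both code states but
multiplies the inner product by a character value different from 1, so the inner product is zero. -/
lemma detects_cssCode_of_phase_notMem {C₁ C₂ : Submodule F (Fin n → F)} {b : Fin n → F}
    (hb : b ∉ euclideanDual C₁) (z : Circle) (a : Fin n → F) :
    Detects (cssCode C₁ C₂) (errorOp z a b) := by
  obtain ⟨c, hc, hbc⟩ : ∃ c ∈ C₁, traceChar F (b ⬝ᵥ c) ≠ 1 := by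
    by_contra! hcon
    refine hb fun y hy => ?_
    rw [dotProduct_comm]
    exact dotProduct_eq_zero_of_traceChar_eq_one hcon hy
  refine ⟨0, fun v hv w hw => ?_⟩
  rw [zero_mul]
  have key : inner ℂ v (errorOp z a b w) =
      traceChar F (b ⬝ᵥ c) * inner ℂ v (errorOp z a b w) := by
    rw [PiLp.inner_apply, Finset.mul_sum]
    refine Fintype.sum_equiv (Equiv.subRight c) _ _ fun x => ?_
    have h1 := (mem_cssCode_iff_periodic.1 hv).1 c hc x
    have h2 := (mem_cssCode_iff_periodic.1 hw).1 c hc (x - a)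
    have h3 : x - a = c + (x - c - a) := by abel
    simp only [Equiv.subRight_apply, RCLike.inner_apply, errorOp_apply]
    rw [h1, sub_right_comm x c a, h2, h3, dotProduct_add, AddChar.map_add_eq_mul]
    rw [show c + (x - c - a) - c = x - c - a by abel]
    ring
  by_contra hne
  exact hbc (mul_right_cancel₀ hne ((one_mul _).trans key)).symm

lemma detects_scalar (Q : Submodule ℂ (QState F n)) (z : Circle) :
    Detects Q (errorOp z 0 0) := by
  refine ⟨z, fun v _ w _ => ?_⟩
  have : errorOp z 0 0 w = (z : ℂ) • w := by
    ext x
    simp [errorOp_apply]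
  rw [this, inner_smul_right]

/-- The CSS construction: if all non-zero words of `C₂` have weight at least `d`, and all
non-zero words of `C₁` and of its dual have weight at least `t ≥ d`, then the code of `C₁ ≤ C₂`
has minimum distance at least `d` and is pure to `t`. -/
theorem isQuantumCode_cssCode [DecidableEq F] {C₁ C₂ : Submodule F (Fin n → F)} (h : C₁ ≤ C₂)
    {d t : ℕ} (hdt : d ≤ t) (h₁ : ∀ c ∈ C₁, c ≠ 0 → t ≤ hammingNorm c)
    (h₂ : ∀ c ∈ C₂, c ≠ 0 → d ≤ hammingNorm c)
    (hdual : ∀ c ∈ euclideanDual C₁, c ≠ 0 → t ≤ hammingNorm c) :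
    IsQuantumCode (cssCode C₁ C₂) ((Module.finrank F C₂ : ℤ) - Module.finrank F C₁) d ∧
      IsPureTo (cssCode C₁ C₂) t := by
  have hpure : IsPureTo (cssCode C₁ C₂) t := by
    intro z a b hfix hpos
    obtain ⟨ha, hb⟩ := mem_of_errorOp_fixes_cssCode h hfix
    by_cases ha0 : a = 0
    · have hb0 : b ≠ 0 := by
        rintro rfl
        simp [errorWeight, ha0] at hpos
      exact (hdual b (euclideanDual_anti h hb) hb0).trans (hammingNorm_le_errorWeight_right a b)
    · exact (h₁ a ha ha0).trans (hammingNorm_le_errorWeight_left a b)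
  refine ⟨⟨isStabilizerCode_cssCode h, ?_, fun z a b hw => ?_, fun _ z a b hfix hpos =>
    hdt.trans (hpure z a b hfix hpos)⟩, hpure⟩
  · rw [finrank_cssCode h, ← Nat.cast_sub (Submodule.finrank_mono h), zpow_natCast, Nat.cast_pow]
  -- An error that is not compressed to zero has both parts in codes of minimum weight at least `d`;
  -- being lighter than that, it is a scalar.
  · by_cases ha : a ∈ C₂
    · by_cases hb : b ∈ euclideanDual C₁
      · have ha0 : a = 0 := by
          by_contra ha0
          exact absurd ((h₂ a ha ha0).trans (hammingNorm_le_errorWeight_left a b)) hw.not_ge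
        have hb0 : b = 0 := by
          by_contra hb0
          exact absurd ((hdt.trans (hdual b hb hb0)).trans
            (hammingNorm_le_errorWeight_right a b)) hw.not_ge
        rw [ha0, hb0]
        exact detects_scalar _ z
      · exact detects_cssCode_of_phase_notMem hb z a
    · exact detects_cssCode_of_shift_notMem ha z b

end QuantumCode

/-! ### BCH codes: dimension, the BCH bound and containment of the dual. -/

section CyclicCode

open Polynomial

variable {F K : Type*} [Field F] [Field K] {n : ℕ}

lemma coeff_wordPoly (c : Fin n → F) (i : Fin n) : (wordPoly c).coeff i = c i := by
  simp [wordPoly, coeff_monomial, Fin.val_inj]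

lemma coeff_wordPoly_of_le (c : Fin n → F) {i : ℕ} (hi : n ≤ i) : (wordPoly c).coeff i = 0 := by
  simp only [wordPoly, finsetSum_coeff, coeff_monomial]
  exact Finset.sum_eq_zero fun j _ => if_neg (by omega)

lemma degree_wordPoly_lt (c : Fin n → F) : (wordPoly c).degree < n :=
  (degree_lt_iff_coeff_zero _ _).2 fun _ hi => coeff_wordPoly_of_le c hi

lemma wordPoly_coeff {P : F[X]} (hP : P.degree < n) :
    wordPoly (fun i : Fin n => P.coeff i) = P := by
  ext i
  rcases lt_or_ge i n with hi | hi
  · exact coeff_wordPoly (fun i : Fin n => P.coeff i) ⟨i, hi⟩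
  · rw [coeff_wordPoly_of_le _ hi, (degree_lt_iff_coeff_zero _ _).1 hP _ hi]

lemma eval_map_wordPoly [Algebra F K] (c : Fin n → F) (x : K) :
    ((wordPoly c).map (algebraMap F K)).eval x = ∑ i, algebraMap F K (c i) * x ^ (i : ℕ) := by
  simp [wordPoly, Polynomial.map_sum, eval_finsetSum]

lemma generatorPoly_monic (α : K) (Z : Finset ℕ) : (generatorPoly α Z).Monic :=
  monic_prod_of_monic _ _ fun _ _ => monic_X_sub_C _

lemma natDegree_generatorPoly (α : K) (Z : Finset ℕ) :
    (generatorPoly α Z).natDegree = Z.card := by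
  rw [generatorPoly, natDegree_prod_of_monic _ _ fun _ _ => monic_X_sub_C _]
  simp only [natDegree_X_sub_C, Finset.sum_const, smul_eq_mul, mul_one]

/-- Exponents below `n` give distinct powers of `α`, so the linear factors are pairwise coprime. -/
lemma generatorPoly_dvd_iff {α : K} (hα : IsPrimitiveRoot α n) {Z : Finset ℕ}
    (hZ : ∀ z ∈ Z, z < n) {p : K[X]} :
    generatorPoly α Z ∣ p ↔ ∀ z ∈ Z, p.eval (α ^ z) = 0 := by
  refine ⟨fun h z hz => ?_, fun h => ?_⟩
  · exact dvd_iff_isRoot.1 ((Finset.dvd_prod_of_mem (fun z => X - C (α ^ z)) hz).trans h)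
  · refine Finset.prod_dvd_of_coprime (fun i hi j hj hij => ?_) fun z hz =>
      dvd_iff_isRoot.2 (h z hz)
    refine isCoprime_X_sub_C_of_isUnit_sub (sub_ne_zero.2 fun he => hij ?_).isUnit
    exact hα.pow_inj (hZ i hi) (hZ j hj) he

lemma cyclotomicCoset_lt {q x z : ℕ} (hz : z ∈ cyclotomicCoset q n x) : z < n := by
  simp only [cyclotomicCoset, Finset.mem_filter, Finset.mem_range] at hz
  exact hz.1

lemma mem_cyclotomicCoset (hn : 0 < n) {q x z : ℕ} :
    z ∈ cyclotomicCoset q n x ↔ ∃ k : ℕ, z = x * q ^ k % n := by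
  simp only [cyclotomicCoset, Finset.mem_filter, Finset.mem_range, and_iff_right_iff_imp]
  rintro ⟨k, rfl⟩
  exact Nat.mod_lt _ hn

lemma bchDefiningSet_lt {q b δ z : ℕ} (hz : z ∈ bchDefiningSet q n b δ) : z < n := by
  obtain ⟨x, -, hx⟩ := Finset.mem_biUnion.1 hz
  exact cyclotomicCoset_lt hx

lemma mem_bchDefiningSet (hn : 0 < n) {q b δ z : ℕ} :
    z ∈ bchDefiningSet q n b δ ↔
      ∃ x, b ≤ x ∧ x < b + δ - 1 ∧ ∃ k : ℕ, z = x * q ^ k % n := by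
  simp only [bchDefiningSet, Finset.mem_biUnion, Finset.mem_Ico, mem_cyclotomicCoset hn, and_assoc]

lemma mul_mod_mem_bchDefiningSet {q b δ z : ℕ} (hz : z ∈ bchDefiningSet q n b δ) :
    z * q % n ∈ bchDefiningSet q n b δ := by
  have hn : 0 < n := (Nat.zero_le z).trans_lt (bchDefiningSet_lt hz)
  obtain ⟨x, h1, h2, k, rfl⟩ := (mem_bchDefiningSet hn).1 hz
  exact (mem_bchDefiningSet hn).2 ⟨x, h1, h2, k + 1, by rw [Nat.mod_mul_mod, pow_succ, mul_assoc]⟩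

lemma bchDefiningSet_mono (q n b : ℕ) {δ δ' : ℕ} (h : δ ≤ δ') :
    bchDefiningSet q n b δ ⊆ bchDefiningSet q n b δ' :=
  Finset.biUnion_subset_biUnion_of_subset_left _
    (Finset.Ico_subset_Ico le_rfl (Nat.sub_le_sub_right (by omega) 1))

variable [Fintype F] [Algebra F K]

lemma bchCode_anti (b : ℕ) (α : K) {δ δ' : ℕ} (h : δ ≤ δ') :
    (bchCode n b δ' α : Submodule F (Fin n → F)) ≤ bchCode n b δ α := fun _ hc =>
  (Finset.prod_dvd_prod_of_subset _ _ _ (bchDefiningSet_mono _ n b h)).trans hc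

lemma mem_bchCode_iff {α : K} (hα : IsPrimitiveRoot α n) {b δ : ℕ} {c : Fin n → F} :
    c ∈ (bchCode n b δ α : Submodule F (Fin n → F)) ↔
      ∀ z ∈ bchDefiningSet (Fintype.card F) n b δ,
        ∑ i, algebraMap F K (c i) * (α ^ z) ^ (i : ℕ) = 0 := by
  simp only [← eval_map_wordPoly]
  exact generatorPoly_dvd_iff hα fun _ => bchDefiningSet_lt

/-- The polynomial `X ^ q - X` already splits over `F`, so its roots in `K` all come from `F`. -/
lemma mem_range_algebraMap_of_pow_card_eq {x : K} (hx : x ^ Fintype.card F = x) :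
    x ∈ (algebraMap F K).range := by
  have hroots := FiniteField.roots_X_pow_card_sub_X F
  have hsplit : ((X ^ Fintype.card F - X : F[X])).Splits := by
    rw [splits_iff_card_roots, hroots,
      FiniteField.X_pow_card_sub_X_natDegree_eq F Fintype.one_lt_card]
    rfl
  have hne : (X ^ Fintype.card F - X : F[X]) ≠ 0 :=
    FiniteField.X_pow_card_sub_X_ne_zero F Fintype.one_lt_card
  exact hsplit.mem_range_of_isRoot (i := algebraMap F K) hne (x := x) (by simp [hx])

/-- A generator polynomial whose set of exponents is closed under multiplication by the size of
the base field modulo `n` has coefficients in the base field. -/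
lemma exists_map_eq_generatorPoly {α : K} (hα : IsPrimitiveRoot α n) {Z : Finset ℕ}
    (hcop : n.Coprime (Fintype.card F)) (hZ : ∀ z ∈ Z, z < n)
    (hclosed : ∀ z ∈ Z, z * Fintype.card F % n ∈ Z) :
    ∃ g : F[X], g.Monic ∧ g.map (algebraMap F K) = generatorPoly α Z := by
  set q := Fintype.card F
  let σ : K →+* K := (FiniteField.frobeniusAlgHom F K : K →+* K)
  have hσ : ∀ x, σ x = x ^ q := fun x => rfl
  -- Multiplication by `q` is injective modulo `n` and hence permutes the finite set `Z`, so
  -- Frobenius permutes the roots and fixes every coefficient.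
  have hmap : (generatorPoly α Z).map σ = generatorPoly α Z := by
    have hinj : Set.InjOn (fun z => z * q % n) (Z : Set ℕ) := by
      intro a ha b hb hab
      have h1 : a ≡ b [MOD n] := Nat.ModEq.cancel_right_of_coprime hcop hab
      exact h1.eq_of_lt_of_lt (hZ a ha) (hZ b hb)
    have hmaps : Set.MapsTo (fun z => z * q % n) (Z : Set ℕ) Z := hclosed
    rw [generatorPoly, Polynomial.map_prod]
    refine Finset.prod_nbij (fun z => z * q % n) hclosed hinj
      (Finset.surjOn_of_injOn_of_card_le _ hmaps hinj le_rfl) fun z _ => ?_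
    rw [Polynomial.map_sub, map_X, map_C, hσ, ← pow_mul, hα.eq_orderOf, pow_mod_orderOf]
  have hlift : generatorPoly α Z ∈ lifts (algebraMap F K) := by
    rw [lifts_iff_coeff_lifts]
    intro i
    have hcoeff := congrArg (fun p => p.coeff i) hmap
    simp only [coeff_map, hσ] at hcoeff
    exact mem_range_algebraMap_of_pow_card_eq hcoeff
  obtain ⟨g, hg, -, hmonic⟩ := lifts_and_degree_eq_and_monic hlift (generatorPoly_monic α Z)
  exact ⟨g, hmonic, hg⟩

lemma mem_bchCode_iff_dvd {α : K} {b δ : ℕ} {g : F[X]}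
    (hg : g.map (algebraMap F K) =
      generatorPoly α (bchDefiningSet (Fintype.card F) n b δ)) {c : Fin n → F} :
    c ∈ (bchCode n b δ α : Submodule F (Fin n → F)) ↔ g ∣ wordPoly c := by
  rw [← map_dvd_map' (algebraMap F K), hg]
  rfl

/-- Multiplication by the generator `g`, of degree `Z.card`, maps the polynomials of degree below `n
- Z.card` isomorphically onto the code. -/
lemma finrank_bchCode {α : K} (hα : IsPrimitiveRoot α n) (hcop : n.Coprime (Fintype.card F))
    (b δ : ℕ) :
    Module.finrank F (bchCode n b δ α : Submodule F (Fin n → F)) =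
      n - (bchDefiningSet (Fintype.card F) n b δ).card := by
  set Z := bchDefiningSet (Fintype.card F) n b δ with hZdef
  obtain ⟨g, hmonic, hg⟩ := exists_map_eq_generatorPoly hα (Z := Z) hcop
    (fun _ => bchDefiningSet_lt) fun _ => mul_mod_mem_bchDefiningSet
  have hdeg : g.natDegree = Z.card := by
    rw [← natDegree_generatorPoly α Z, ← hg, natDegree_map]
  have hcard : Z.card ≤ n := by
    simpa using Finset.card_le_card (t := Finset.range n) fun z hz =>
      Finset.mem_range.2 (bchDefiningSet_lt hz)
  have hdegree : ∀ p : F[X], (g * p).degree < n ↔ p.degree < (n - Z.card : ℕ) := by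
    intro p
    rw [degree_mul, degree_eq_natDegree hmonic.ne_zero, hdeg]
    by_cases hp : p = 0
    · simp [hp]
    · rw [degree_eq_natDegree hp]
      norm_cast
      omega
  let φ : degreeLT F (n - Z.card) →ₗ[F] (Fin n → F) :=
    { toFun := fun p i => (g * (p : F[X])).coeff i
      map_add' := fun p r => by ext i; simp [mul_add]
      map_smul' := fun r p => by ext i; simp }
  have hword : ∀ p, wordPoly (φ p) = g * (p : F[X]) := fun p =>
    wordPoly_coeff ((hdegree _).2 (mem_degreeLT.1 p.2))
  have hinj : Function.Injective φ := by
    intro p r h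
    have := (hword p).symm.trans ((congrArg wordPoly h).trans (hword r))
    exact Subtype.ext (mul_left_cancel₀ hmonic.ne_zero this)
  have hrange : LinearMap.range φ = bchCode n b δ α := by
    ext c
    rw [mem_bchCode_iff_dvd hg]
    refine ⟨?_, ?_⟩
    · rintro ⟨p, rfl⟩
      exact ⟨p, hword p⟩
    · rintro ⟨p, hp⟩
      have hlt : p.degree < (n - Z.card : ℕ) := by
        rw [← hdegree, ← hp]
        exact degree_wordPoly_lt c
      refine ⟨⟨p, mem_degreeLT.2 hlt⟩, ?_⟩
      ext i
      change (g * p).coeff i = c i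
      rw [← hp, coeff_wordPoly]
  rw [← hrange, LinearMap.finrank_range_of_inj hinj, (degreeLTEquiv F _).finrank_eq]
  simp

/-- The BCH bound for narrow-sense codes. -/
lemma le_hammingNorm_of_mem_narrowSenseBCH [DecidableEq F] {α : K} (hα : IsPrimitiveRoot α n)
    {δ : ℕ} (hδ : δ ≤ n) {c : Fin n → F}
    (hc : c ∈ (narrowSenseBCH n δ α : Submodule F (Fin n → F))) (hc0 : c ≠ 0) :
    δ ≤ hammingNorm c := by
  classical
  by_contra! hlt
  obtain ⟨i₀, hi₀⟩ := Function.ne_iff.1 hc0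
  have hi₀' : c i₀ ≠ 0 := hi₀
  have hn : 0 < n := i₀.pos
  have hα0 : α ≠ 0 := hα.ne_zero hn.ne'
  -- This is the root `α ^ (t + 1)`; the separate factor `α ^ i` appears because the consecutive
  -- roots start at exponent 1.
  have hzero : ∀ t < δ - 1,
      ∑ i, algebraMap F K (c i) * (α ^ (i : ℕ) * (α ^ (i : ℕ)) ^ t) = 0 := by
    intro t ht
    have h1 := (mem_bchCode_iff hα).1 hc (t + 1)
      ((mem_bchDefiningSet hn).2 ⟨t + 1, by omega, by omega, 0, by
        rw [pow_zero, mul_one, Nat.mod_eq_of_lt (by omega)]⟩)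
    rw [← h1]
    refine Finset.sum_congr rfl fun i _ => ?_
    rw [← pow_succ', ← pow_mul, ← pow_mul, mul_comm]
    ring
  have hpoly : ∀ p : K[X], p.natDegree < δ - 1 →
      ∑ i, algebraMap F K (c i) * (α ^ (i : ℕ) * p.eval (α ^ (i : ℕ))) = 0 := by
    intro p hp
    simp only [eval_eq_sum_range, Finset.mul_sum]
    rw [Finset.sum_comm]
    refine Finset.sum_eq_zero fun t ht => ?_
    have h1 := congrArg (fun x => p.coeff t * x) (hzero t (by
      have := Finset.mem_range.1 ht
      omega))
    simp only [mul_zero, Finset.mul_sum] at h1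
    rw [← h1]
    exact Finset.sum_congr rfl fun i _ => by ring
  set S : Finset (Fin n) := Finset.univ.filter fun i => c i ≠ 0 with hS
  have hi₀S : i₀ ∈ S := by simp [hS, hi₀']
  have hScard : S.card = hammingNorm c := rfl
  have hpos : 0 < S.card := Finset.card_pos.2 ⟨i₀, hi₀S⟩
  -- This `p` vanishes at every position of the support except `i₀`, and its degree is the weight
  -- minus one, hence below `δ - 1`. Only a non-zero term then survives in `hpoly`.
  set p : K[X] := ∏ j ∈ S.erase i₀, (X - C (α ^ (j : ℕ))) with hp
  have hdeg : p.natDegree < δ - 1 := by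
    rw [hp, natDegree_prod_of_monic _ _ fun _ _ => monic_X_sub_C _]
    simp only [natDegree_X_sub_C, Finset.sum_const, smul_eq_mul, mul_one]
    rw [Finset.card_erase_of_mem hi₀S]
    omega
  have hsum := hpoly p hdeg
  rw [Finset.sum_eq_single i₀] at hsum
  · have hev : p.eval (α ^ (i₀ : ℕ)) ≠ 0 := by
      rw [hp, eval_prod, Finset.prod_ne_zero_iff]
      intro j hj
      rw [eval_sub, eval_X, eval_C, sub_ne_zero]
      intro he
      exact (Finset.ne_of_mem_erase hj) (Fin.ext (hα.pow_inj i₀.2 j.2 he)).symm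
    exact mul_ne_zero ((_root_.map_ne_zero _).2 hi₀') (mul_ne_zero (pow_ne_zero _ hα0) hev) hsum
  · intro j _ hj
    by_cases hcj : c j = 0
    · simp [hcj]
    · have : p.eval (α ^ (j : ℕ)) = 0 := by
        rw [hp, eval_prod]
        exact Finset.prod_eq_zero (i := j)
          (Finset.mem_erase.2 ⟨hj, by simp [hS, hcj]⟩) (by simp)
      simp [this]
  · simp

/-- A BCH code contains its Euclidean dual if no two elements of its defining set add up to zero
modulo `n`. -/
lemma euclideanDual_bchCode_le {α : K} (hα : IsPrimitiveRoot α n)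
    (hcop : n.Coprime (Fintype.card F)) {b δ : ℕ}
    (hZ : ∀ z ∈ bchDefiningSet (Fintype.card F) n b δ,
      ∀ w ∈ bchDefiningSet (Fintype.card F) n b δ, ¬ n ∣ z + w) :
    euclideanDual (bchCode n b δ α : Submodule F (Fin n → F)) ≤ bchCode n b δ α := by
  intro y hy
  rw [mem_bchCode_iff hα]
  intro z hz
  set Z := bchDefiningSet (Fintype.card F) n b δ with hZdef
  obtain ⟨g, hmonic, hg⟩ := exists_map_eq_generatorPoly hα (Z := Z) hcop
    (fun _ => bchDefiningSet_lt) fun _ => mul_mod_mem_bchDefiningSet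
  -- The value at `α ^ w` is the geometric sum of `α ^ (z + w)`, an `n`-th root of unity other than
  -- 1. So `g` divides the word of powers of `α ^ z`, and this word is a `K`-combination of shifts
  -- of `g`, all orthogonal to `y`.
  have hroot : ∀ w ∈ Z, (wordPoly fun i : Fin n => (α ^ z) ^ (i : ℕ)).eval (α ^ w) = 0 := by
    intro w hw
    have h1 := eval_map_wordPoly (F := K) (fun i : Fin n => (α ^ z) ^ (i : ℕ)) (α ^ w)
    simp only [Algebra.algebraMap_self, Polynomial.map_id, RingHom.id_apply, ← mul_pow,
      ← pow_add] at h1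
    rw [h1, Fin.sum_univ_eq_sum_range fun i => (α ^ (z + w)) ^ i]
    have hne : α ^ (z + w) - 1 ≠ 0 := sub_ne_zero.2 fun h =>
      hZ z hz w hw (hα.dvd_of_pow_eq_one _ h)
    refine (mul_eq_zero.1 ((geom_sum_mul (α ^ (z + w)) n).trans ?_)).resolve_right hne
    rw [← pow_mul, mul_comm, pow_mul, hα.pow_eq_one, one_pow, sub_self]
  obtain ⟨P, hP⟩ := (generatorPoly_dvd_iff hα fun _ => bchDefiningSet_lt).2 hroot
  have hort : ∀ j : ℕ, (g * X ^ j).degree < (n : WithBot ℕ) →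
      ∑ i : Fin n, algebraMap F K ((g * X ^ j).coeff i) * algebraMap F K (y i) = 0 := by
    intro j hj
    have h1 := hy (fun i => (g * X ^ j).coeff i)
      ((mem_bchCode_iff_dvd hg).2 (by rw [wordPoly_coeff hj]; exact dvd_mul_right _ _))
    have h2 := congrArg (algebraMap F K) h1
    simpa [dotProduct] using h2
  have hcoeff : ∀ i : Fin n, (α ^ z) ^ (i : ℕ) =
      ∑ j ∈ Finset.range (P.natDegree + 1),
        P.coeff j * algebraMap F K ((g * X ^ j).coeff i) := by
    intro i
    rw [← coeff_wordPoly (fun i : Fin n => (α ^ z) ^ (i : ℕ)) i, hP, ← hg]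
    conv_lhs => rw [P.as_sum_range_C_mul_X_pow, Finset.mul_sum, finsetSum_coeff]
    refine Finset.sum_congr rfl fun j _ => ?_
    rw [mul_left_comm, coeff_C_mul, ← coeff_map, Polynomial.map_mul, Polynomial.map_pow, map_X]
  simp only [hcoeff, Finset.mul_sum]
  rw [Finset.sum_comm]
  refine Finset.sum_eq_zero fun j hj => ?_
  -- The index `j = 0` occurs even for `P = 0`, since `natDegree 0 = 0`. For `P ≠ 0`, the bound `j ≤
  -- natDegree P` keeps the shift of `g` within length `n`.
  by_cases hP0 : P = 0
  · simp [hP0]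
  have hdeg : (g * X ^ j).degree < (n : WithBot ℕ) := by
    have h1 := degree_wordPoly_lt fun i : Fin n => (α ^ z) ^ (i : ℕ)
    rw [hP, ← hg, degree_mul, degree_map, degree_eq_natDegree hP0,
      degree_eq_natDegree hmonic.ne_zero] at h1
    rw [degree_mul, degree_X_pow, degree_eq_natDegree hmonic.ne_zero]
    have h2 := Finset.mem_range.1 hj
    norm_cast at h1 ⊢
    omega
  have h3 := congrArg (fun x => P.coeff j * x) (hort j hdeg)
  simp only [mul_zero, Finset.mul_sum] at h3
  rw [← h3]
  exact Finset.sum_congr rfl fun i _ => by ring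

end CyclicCode

/-! ### Arithmetic of cyclotomic cosets below the bound on the designed distance. -/

section BCHParameters

/-- The bound on the designed distance makes all `x q ^ k + y` with `x, y < δ` and `k ≤ m / 2`
smaller than `n`. -/
lemma mul_pow_add_lt_of_le {q n m δ x y k : ℕ} (hq : 2 ≤ q) (hm : 2 ≤ m) (hn : 0 < n)
    (hdvd : n ∣ q ^ m - 1)
    (h : (δ : ℝ) ≤ (n : ℝ) / ((q : ℝ) ^ m - 1) *
      ((q : ℝ) ^ ⌈(m : ℝ) / 2⌉₊ - 1 - ((q : ℝ) - 2) * (if Odd m then 1 else 0)))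
    (hx : x < δ) (hy : y < δ) (hk : k ≤ m / 2) : x * q ^ k + y < n := by
  have hq1 : (2 : ℝ) ≤ q := by exact_mod_cast hq
  have hpow : 1 < q ^ m := Nat.one_lt_pow (by omega) (by omega)
  have hle : (n : ℝ) ≤ (q : ℝ) ^ m - 1 := by
    have h1 : n + 1 ≤ q ^ m := by
      have := Nat.le_of_dvd (by omega) hdvd
      omega
    have h2 : (n : ℝ) + 1 ≤ (q : ℝ) ^ m := by exact_mod_cast h1
    linarith
  have hn' : (0 : ℝ) < n := by exact_mod_cast hn
  have hN : (0 : ℝ) < (q : ℝ) ^ m - 1 := hn'.trans_le hle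
  rw [div_mul_eq_mul_div, le_div_iff₀ hN] at h
  -- The extreme case is `x = y = δ - 1`, `k = m / 2`. For even `m` the hypothesis even gives `δ (A
  -- + 1) ≤ n`, because `q ^ m - 1 = (A - 1) (A + 1)`.
  have hmain : ((δ : ℝ) - 1) * ((q : ℝ) ^ (m / 2) + 1) < n := by
    set A : ℝ := (q : ℝ) ^ (m / 2) with hA
    have hA0 : 0 < A := by positivity
    refine lt_of_mul_lt_mul_right ?_ hN.le
    rcases Nat.even_or_odd' m with ⟨l, rfl | rfl⟩
    · have hl : 2 * l / 2 = l := by omega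
      have hceil : ⌈((2 * l : ℕ) : ℝ) / 2⌉₊ = l := by
        rw [Nat.cast_mul, Nat.cast_ofNat, mul_div_cancel_left₀ _ two_ne_zero, Nat.ceil_natCast]
      have hsq : (q : ℝ) ^ (2 * l) = A * A := by rw [hA, hl, two_mul, pow_add]
      have hodd : ¬ Odd (2 * l) := by simp
      rw [hceil, if_neg hodd, ← hl, ← hA, hl, mul_zero, sub_zero] at h
      have h1 := mul_le_mul_of_nonneg_right h (by positivity : 0 ≤ A + 1)
      have h2 : (n : ℝ) * (A - 1) * (A + 1) = n * ((q : ℝ) ^ (2 * l) - 1) := by rw [hsq]; ring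
      have h3 : 0 < (A + 1) * ((q : ℝ) ^ (2 * l) - 1) := by positivity
      nlinarith
    · have hl : (2 * l + 1) / 2 = l := by omega
      have hceil : ⌈((2 * l + 1 : ℕ) : ℝ) / 2⌉₊ = l + 1 := by
        rw [Nat.ceil_eq_iff (by omega)]
        push_cast
        constructor <;> linarith
      have hsq : (q : ℝ) ^ (2 * l + 1) = A * A * q := by
        rw [hA, hl, pow_succ, two_mul, pow_add]
      have hodd : Odd (2 * l + 1) := by simp
      have hsucc : (q : ℝ) ^ (l + 1) = A * q := by rw [hA, hl, pow_succ]
      rw [hceil, if_pos hodd, hsucc, mul_one] at h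
      have h1 := mul_le_mul_of_nonneg_right h (by positivity : 0 ≤ A + 1)
      -- For odd `m` the product exceeds `n (q ^ m - 1)` by `n (A + 2 - q)`. As `q ≥ 2` and `n ≤ q ^
      -- m - 1`, passing from `δ` to `δ - 1` absorbs this excess.
      have h2 : (n : ℝ) * (A * q - 1 - (q - 2)) * (A + 1) =
          n * ((q : ℝ) ^ (2 * l + 1) - 1) + n * (A + 2 - q) := by rw [hsq]; ring
      have h3 : (n : ℝ) * (A + 2 - q) < ((q : ℝ) ^ (2 * l + 1) - 1) * (A + 1) := by
        calc (n : ℝ) * (A + 2 - q) < n * (A + 1) := by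
              refine mul_lt_mul_of_pos_left ?_ hn'
              linarith
          _ ≤ _ := mul_le_mul_of_nonneg_right hle (by positivity)
      nlinarith
  have hx' : (x : ℝ) ≤ δ - 1 := by
    have : (x : ℝ) + 1 ≤ δ := by exact_mod_cast hx
    linarith
  have hy' : (y : ℝ) ≤ δ - 1 := by
    have : (y : ℝ) + 1 ≤ δ := by exact_mod_cast hy
    linarith
  have hkpow : (q : ℝ) ^ k ≤ (q : ℝ) ^ (m / 2) := pow_le_pow_right₀ (by linarith) hk
  have hfin : (x : ℝ) * (q : ℝ) ^ k + y < n := by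
    refine lt_of_le_of_lt ?_ hmain
    have h4 : (x : ℝ) * (q : ℝ) ^ k ≤ (δ - 1) * (q : ℝ) ^ (m / 2) :=
      mul_le_mul hx' hkpow (by positivity) (by linarith [Nat.cast_nonneg (α := ℝ) x])
    linarith
  exact_mod_cast hfin

variable {q n m δ : ℕ}

/-- Two sufficiently small numbers of which one is congruent to a power of `q` times the other
are equal up to a power of `q`. -/
lemma mul_pow_eq_of_natCast_eq
    (hb : ∀ x y k, x < δ → y < δ → k ≤ m / 2 → x * q ^ k + y < n) {x y k : ℕ}
    (hx : x < δ) (hy : y < δ) (hk : k ≤ m / 2)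
    (h : (x : ZMod n) * (q : ZMod n) ^ k = y) : x * q ^ k = y := by
  have h1 : x * q ^ k ≡ y [MOD n] := by
    rw [← ZMod.natCast_eq_natCast_iff]
    exact_mod_cast h
  have h2 := hb x y k hx hy hk
  exact h1.eq_of_lt_of_lt (by omega) (by omega)

/-- A zero sum can be multiplied by a power of `q` to read `x q^j + y ≡ 0` with `j < m`. If `j > m /
2`, multiplying by `q ^ (m - j)` exchanges `x` and `y`. Either way a positive number below `n` would
be divisible by `n`. -/
lemma not_dvd_add_of_mem_bchDefiningSet (hq : 2 ≤ q) (hm : m = orderOf (q : ZMod n))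
    (hm0 : 0 < m) (hn : 0 < n)
    (hb : ∀ x y k, x < δ → y < δ → k ≤ m / 2 → x * q ^ k + y < n) :
    ∀ z ∈ bchDefiningSet q n 1 δ, ∀ w ∈ bchDefiningSet q n 1 δ, ¬ n ∣ z + w := by
  intro z hz w hw hdvd
  obtain ⟨x, hx1, hx2, k, rfl⟩ := (mem_bchDefiningSet hn).1 hz
  obtain ⟨y, hy1, hy2, l, rfl⟩ := (mem_bchDefiningSet hn).1 hw
  have hqm : (q : ZMod n) ^ m = 1 := by rw [hm, pow_orderOf_eq_one]
  have h0 : (x : ZMod n) * (q : ZMod n) ^ k + y * (q : ZMod n) ^ l = 0 := by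
    have := (ZMod.natCast_eq_zero_iff _ _).2 hdvd
    simpa using this
  have hcontra : ∀ x y j : ℕ, 1 ≤ x → x < δ → y < δ → j ≤ m / 2 →
      (x : ZMod n) * (q : ZMod n) ^ j + y ≠ 0 := by
    intro x y j hx1 hx hy hj h
    have h1 : n ∣ x * q ^ j + y := by
      rw [← ZMod.natCast_eq_zero_iff]
      exact_mod_cast h
    have hqpos : 0 < q := by omega
    have h2 := Nat.le_of_dvd (by positivity) h1
    have h3 := hb x y j hx hy hj
    omega
  -- Modulo `m` this is `k - l`, written without subtraction.
  set j := (k + (m - 1) * l) % m with hj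
  have hjm : j < m := Nat.mod_lt _ hm0
  have h1 : (x : ZMod n) * (q : ZMod n) ^ j + y = 0 := by
    have hml : l + (m - 1) * l = m * l := by
      obtain ⟨m', rfl⟩ : ∃ m', m = m' + 1 := ⟨m - 1, by omega⟩
      simp
      ring
    rw [hj]
    conv_lhs => rw [hm, pow_mod_orderOf, ← hm]
    calc _ = (x * (q : ZMod n) ^ k + y * (q : ZMod n) ^ l) * (q : ZMod n) ^ ((m - 1) * l) := by
          rw [add_mul, mul_assoc, mul_assoc, ← pow_add, ← pow_add, hml, pow_mul _ m l, hqm,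
            one_pow, mul_one]
      _ = 0 := by rw [h0, zero_mul]
  by_cases hjle : j ≤ m / 2
  · exact hcontra x y j hx1 (by omega) (by omega) hjle h1
  · refine hcontra y x (m - j) hy1 (by omega) (by omega) (by omega) ?_
    have h2 : (q : ZMod n) ^ j * (q : ZMod n) ^ (m - j) = 1 := by
      rw [← pow_add, Nat.add_sub_cancel' hjm.le, hqm]
    have h3 := congrArg (· * (q : ZMod n) ^ (m - j)) h1
    simp only [add_mul, zero_mul, mul_assoc, h2, mul_one] at h3
    rw [add_comm]
    exact h3

/-- Factors `q` of a representative can be moved into the power, leaving the `x < δ` with `q ∤ x`. A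
coincidence `x q^j ≡ y` between two of these, with `j ≤ m / 2`, is an equality of integers, so `q ∤
y` forces `j = 0`; a larger `j` is reversed to `m - j > 0` and contradicts `q ∤ x`. -/
lemma card_bchDefiningSet (hq : 2 ≤ q) (hm : m = orderOf (q : ZMod n)) (hm0 : 0 < m)
    (hn : 0 < n) (hb : ∀ x y k, x < δ → y < δ → k ≤ m / 2 → x * q ^ k + y < n) :
    (bchDefiningSet q n 1 δ).card = m * (δ - 1 - (δ - 1) / q) := by
  classical
  have hqm : (q : ZMod n) ^ m = 1 := by rw [hm, pow_orderOf_eq_one]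
  set S : Finset ℕ := (Finset.Ioc 0 (δ - 1)).filter fun x => ¬ q ∣ x with hS
  have hScard : S.card = δ - 1 - (δ - 1) / q := by
    have h1 := Finset.card_filter_add_card_filter_not (s := Finset.Ioc 0 (δ - 1)) (fun x => q ∣ x)
    rw [Nat.Ioc_filter_dvd_card_eq_div, Nat.card_Ioc, Nat.sub_zero] at h1
    exact Nat.eq_sub_of_add_eq' h1
  have himage : bchDefiningSet q n 1 δ =
      (S ×ˢ Finset.range m).image fun p => p.1 * q ^ p.2 % n := by
    ext z
    rw [mem_bchDefiningSet hn, Finset.mem_image]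
    constructor
    · rintro ⟨x, hx1, hx2, k, rfl⟩
      obtain ⟨e, x', hx', rfl⟩ :=
        Nat.exists_eq_pow_mul_and_not_dvd (n := x) (by omega) q (by omega)
      have hle : x' ≤ q ^ e * x' := Nat.le_mul_of_pos_left _ (by positivity)
      have hpos : 0 < x' := Nat.pos_of_ne_zero fun h0 => hx' (h0 ▸ dvd_zero q)
      refine ⟨(x', (e + k) % m), ?_, ?_⟩
      · simp only [hS, Finset.mem_product, Finset.mem_filter, Finset.mem_Ioc, Finset.mem_range]
        exact ⟨⟨⟨hpos, by omega⟩, hx'⟩, Nat.mod_lt _ hm0⟩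
      · change _ ≡ _ [MOD n]
        rw [← ZMod.natCast_eq_natCast_iff]
        push_cast
        rw [hm, pow_mod_orderOf, pow_add]
        ring
    · rintro ⟨⟨x, k⟩, hp, rfl⟩
      simp only [hS, Finset.mem_product, Finset.mem_filter, Finset.mem_Ioc] at hp
      exact ⟨x, by omega, by omega, k, rfl⟩
  have hkey : ∀ x y j, x ∈ S → y ∈ S → j < m → (x : ZMod n) * (q : ZMod n) ^ j = y →
      x = y ∧ j = 0 := by
    intro x y j hx hy hj h
    simp only [hS, Finset.mem_filter, Finset.mem_Ioc] at hx hy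
    by_cases hjle : j ≤ m / 2
    · have h1 := mul_pow_eq_of_natCast_eq hb (x := x) (y := y) (by omega) (by omega) hjle h
      rcases Nat.eq_zero_or_pos j with rfl | hj0
      · exact ⟨by simpa using h1, rfl⟩
      · exact absurd (h1 ▸ dvd_mul_of_dvd_right (dvd_pow_self q hj0.ne') x) hy.2
    · have h2 : (y : ZMod n) * (q : ZMod n) ^ (m - j) = x := by
        rw [← h, mul_assoc, ← pow_add, Nat.add_sub_cancel' hj.le, hqm, mul_one]
      have h1 := mul_pow_eq_of_natCast_eq hb (x := y) (y := x) (by omega) (by omega) (by omega) h2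
      exact absurd (h1 ▸ dvd_mul_of_dvd_right (dvd_pow_self q (by omega)) y) hx.2
  have hkey' : ∀ x y j k, x ∈ S → y ∈ S → j < m → k ≤ j →
      (x : ZMod n) * (q : ZMod n) ^ j = y * (q : ZMod n) ^ k → x = y ∧ j = k := by
    intro x y j k hx hy hj hkj h
    have hunit : IsUnit ((q : ZMod n) ^ k) := (IsUnit.of_pow_eq_one hqm hm0.ne').pow k
    have h1 : (x : ZMod n) * (q : ZMod n) ^ (j - k) = y := by
      refine hunit.mul_right_cancel ?_
      rw [mul_assoc, ← pow_add, Nat.sub_add_cancel hkj, h]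
    obtain ⟨h2, h3⟩ := hkey x y (j - k) hx hy (by omega) h1
    exact ⟨h2, by omega⟩
  rw [himage, Finset.card_image_of_injOn, Finset.card_product, Finset.card_range, hScard,
    mul_comm]
  rintro ⟨x, j⟩ hx ⟨y, k⟩ hy hxy
  rw [Finset.mem_coe, Finset.mem_product, Finset.mem_range] at hx hy
  have h : (x : ZMod n) * (q : ZMod n) ^ j = y * (q : ZMod n) ^ k := by
    have h1 : x * q ^ j ≡ y * q ^ k [MOD n] := hxy
    rw [← ZMod.natCast_eq_natCast_iff] at h1
    exact_mod_cast h1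
  rcases le_total k j with hkj | hjk
  · obtain ⟨h1, h2⟩ := hkey' x y j k hx.1 hy.1 hx.2 hkj h
    rw [h1, h2]
  · obtain ⟨h1, h2⟩ := hkey' y x k j hy.1 hx.1 hy.2 hjk h.symm
    rw [h1, h2]

lemma floor_natCast_sub_one_div (q : ℕ) {δ : ℕ} (hδ : 1 ≤ δ) :
    ⌊((δ : ℝ) - 1) / q⌋ = (((δ - 1) / q : ℕ) : ℤ) := by
  rw [Int.floor_div_natCast, ← Nat.cast_pred hδ, Int.floor_natCast, Int.natCast_div]

end BCHParameters

theorem mainTheorem12 {F : Type*} [Field F] [Fintype F] (q n m δ₁ δ₂ : ℕ)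
    (hq : Fintype.card F = q) (hm : m = orderOf (q : ZMod n)) (hm2 : 2 ≤ m)
    (h₁ : 2 ≤ δ₁) (h₁₂ : δ₁ < δ₂)
    (h₂ : (δ₂ : ℝ) ≤ (n : ℝ) / ((q : ℝ) ^ m - 1) *
      ((q : ℝ) ^ ⌈(m : ℝ) / 2⌉₊ - 1 - ((q : ℝ) - 2) * (if Odd m then 1 else 0))) :
    (∃ Q : Submodule ℂ (QState F n),
      IsQuantumCode Q ((m : ℤ) * ((δ₂ : ℤ) - δ₁ - ⌊((δ₂ : ℝ) - 1) / q⌋ + ⌊((δ₁ : ℝ) - 1) / q⌋)) δ₁ ∧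
      IsPureTo Q δ₂) ∧
    (∀ α : AlgebraicClosure F, IsPrimitiveRoot α n →
      (narrowSenseBCH n δ₂ α : Submodule F (Fin n → F)) ≤ narrowSenseBCH n δ₁ α ∧
      IsQuantumCode (cssCode (narrowSenseBCH n δ₂ α : Submodule F (Fin n → F))
          (narrowSenseBCH n δ₁ α))
        ((m : ℤ) * ((δ₂ : ℤ) - δ₁ - ⌊((δ₂ : ℝ) - 1) / q⌋ + ⌊((δ₁ : ℝ) - 1) / q⌋)) δ₁ ∧
      IsPureTo (cssCode (narrowSenseBCH n δ₂ α : Submodule F (Fin n → F))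
          (narrowSenseBCH n δ₁ α)) δ₂) := by
  classical
  subst hq
  set q := Fintype.card F with hqdef
  have hq2 : 2 ≤ q := Fintype.one_lt_card
  have hm0 : 0 < m := by omega
  -- A positive order makes `q` a unit modulo `n`, so `m ≥ 2` already yields that `n` is positive
  -- and coprime to `q`.
  have hqm : (q : ZMod n) ^ m = 1 := by rw [hm, pow_orderOf_eq_one]
  have hdvd : n ∣ q ^ m - 1 := by
    rw [← ZMod.natCast_eq_zero_iff, Nat.cast_sub (Nat.one_le_pow _ _ (by omega))]
    simp [hqm]
  have hn : 0 < n := Nat.pos_of_dvd_of_pos hdvd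
    (Nat.sub_pos_of_lt (Nat.one_lt_pow (by omega) (by omega)))
  have hcop : n.Coprime q :=
    ((ZMod.isUnit_iff_coprime q n).1 (IsUnit.of_pow_eq_one hqm hm0.ne')).symm
  have hb : ∀ x y k, x < δ₂ → y < δ₂ → k ≤ m / 2 → x * q ^ k + y < n :=
    fun x y k hx hy hk => mul_pow_add_lt_of_le hq2 hm2 hn hdvd h₂ hx hy hk
  have hb₁ : ∀ x y k, x < δ₁ → y < δ₁ → k ≤ m / 2 → x * q ^ k + y < n :=
    fun x y k hx hy hk => hb x y k (hx.trans h₁₂) (hy.trans h₁₂) hk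
  have hδn : δ₂ ≤ n := by
    have := hb (δ₂ - 1) (δ₂ - 1) 0 (by omega) (by omega) (Nat.zero_le _)
    rw [pow_zero] at this
    omega
  have hα : ∀ α : AlgebraicClosure F, IsPrimitiveRoot α n →
      (narrowSenseBCH n δ₂ α : Submodule F (Fin n → F)) ≤ narrowSenseBCH n δ₁ α ∧
      IsQuantumCode (cssCode (narrowSenseBCH n δ₂ α : Submodule F (Fin n → F))
          (narrowSenseBCH n δ₁ α))
        ((m : ℤ) * ((δ₂ : ℤ) - δ₁ - ⌊((δ₂ : ℝ) - 1) / q⌋ + ⌊((δ₁ : ℝ) - 1) / q⌋)) δ₁ ∧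
      IsPureTo (cssCode (narrowSenseBCH n δ₂ α : Submodule F (Fin n → F))
          (narrowSenseBCH n δ₁ α)) δ₂ := by
    intro α hα
    have hle : (narrowSenseBCH n δ₂ α : Submodule F (Fin n → F)) ≤ narrowSenseBCH n δ₁ α :=
      bchCode_anti 1 α h₁₂.le
    have hdist : ∀ c ∈ (narrowSenseBCH n δ₂ α : Submodule F (Fin n → F)), c ≠ 0 →
        δ₂ ≤ hammingNorm c := fun c => le_hammingNorm_of_mem_narrowSenseBCH hα hδn
    have hdual : euclideanDual (narrowSenseBCH n δ₂ α : Submodule F (Fin n → F)) ≤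
        narrowSenseBCH n δ₂ α :=
      euclideanDual_bchCode_le hα hcop (not_dvd_add_of_mem_bchDefiningSet hq2 hm hm0 hn hb)
    have hcss := isQuantumCode_cssCode hle h₁₂.le hdist
      (fun c => le_hammingNorm_of_mem_narrowSenseBCH hα (h₁₂.le.trans hδn))
      fun c hc => hdist c (hdual hc)
    refine ⟨hle, ?_, hcss.2⟩
    convert! hcss.1 using 1
    -- The dimensions are truncated differences; this bound makes them true ones.
    have hcard : ∀ δ, (bchDefiningSet q n 1 δ).card ≤ n := fun δ => by
      simpa using Finset.card_le_card (t := Finset.range n) fun z hz =>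
        Finset.mem_range.2 (bchDefiningSet_lt (q := q) (b := 1) (δ := δ) hz)
    rw [narrowSenseBCH, narrowSenseBCH, finrank_bchCode hα hcop, finrank_bchCode hα hcop,
      Nat.cast_sub (hcard _), Nat.cast_sub (hcard _), card_bchDefiningSet hq2 hm hm0 hn hb,
      card_bchDefiningSet hq2 hm hm0 hn hb₁, floor_natCast_sub_one_div q (by omega : 1 ≤ δ₂),
      floor_natCast_sub_one_div q (by omega : 1 ≤ δ₁), Nat.cast_mul, Nat.cast_mul,
      Nat.cast_sub (Nat.div_le_self _ _), Nat.cast_sub (Nat.div_le_self _ _),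
      Nat.cast_sub (by omega), Nat.cast_sub (by omega)]
    push_cast
    ring
  refine ⟨?_, hα⟩
  -- The characteristic divides `q`, hence not `n`, so the algebraic closure contains a primitive
  -- `n`-th root of unity.
  have hn0 : ((n : ℕ) : F) ≠ 0 := by
    intro h0
    have h1 : ringChar F ∣ n := (ringChar.spec F n).1 h0
    have h2 : ringChar F ∣ q := (ringChar.spec F q).1 (FiniteField.cast_card_eq_zero F)
    have h3 := Nat.dvd_gcd h1 h2
    rw [hcop, Nat.dvd_one] at h3
    exact CharP.ringChar_ne_one h3
  have : NeZero (n : F) := ⟨hn0⟩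
  obtain ⟨α, hprim⟩ := HasEnoughRootsOfUnity.exists_primitiveRoot (AlgebraicClosure F) n
  exact ⟨_, (hα α hprim).2⟩
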